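/- All semigroups are nonempty. A finite semigroup $S$ is \emph{aperiodic} if for every $x\in S$ there is $n\ge 1$ with $x^{n}=x^{n+1}$, and \emph{inverse} if for every $x\in S$ there is exactly one $y\in S$ with $xyx=x$ and $yxy=y$. Let $S^1$ denote $S$ with an identity adjoined if it has none. For $x_1,\dots,x_t\in S$ and $z_1,z_2,\dots\in S^1$ define $\lambda_{0,i}=x_i$ and $$\lambda_{n+1,i}=\lambda_{n,i}\,z_{n+1}\,\lambda_{n,i+1}\,z_{n+1}\cdots\lambda_{n,t}\,z_{n+1}\,\lambda_{n,1}\,z_{n+1}\cdots z_{n+1}\,\lambda_{n,i-1}\qquad(1\le i\le t).$$ The semigroup $S$ is \emph{strongly Mal'cev nilpotent} if there is an integer $n\ge 1$ such that for every $t\ge 1$, all $x_1,\dots,x_t\in S$ and all $z_1,\dots,z_n\in S^1$ one has $\lambda_{n,1}=\lambda_{n,2}=\cdots=\lambda_{n,t}$. A \emph{pseudovariety} is a class of finite semigroups closed under taking subsemigroups, homomorphic images and finite direct products. Let $\mathsf{A}$, $\mathsf{Inv}$ and $\mathsf{SMN}$ be the classes of all finite aperiodic, finite inverse, and finite strongly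 Mal'cev nilpotent semigroups, and let $\langle\mathsf{A}\cap\mathsf{Inv}\rangle$ be the pseudovariety generated by $\mathsf{A}\cap\mathsf{Inv}$, that is, the smallest pseudovariety containing it. Then $$\langle\mathsf{A}\cap\mathsf{Inv}\rangle\subsetneqq\mathsf{A}\cap\mathsf{SMN}.$$ -/

import Mathlib

universe u

/-- A finite (nonempty) semigroup. -/
structure FiniteSemigroup : Type (u + 1) where
  carrier : Type u
  [semigroup : Semigroup carrier]
  [finite : Finite carrier]
  [nonempty : Nonempty carrier]

namespace FiniteSemigroup

instance : CoeSort FiniteSemigroup.{u} (Type u) := ⟨carrier⟩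

attribute [instance] semigroup finite nonempty

/-- The direct product of finitely many finite semigroups (trivial if `k = 0`). -/
def prod {k : ℕ} (S : Fin k → FiniteSemigroup.{u}) : FiniteSemigroup.{u} where
  carrier := ∀ i, S i

/-- A pseudovariety: a class of finite semigroups closed under taking subsemigroups (up to
isomorphism, that is, under injective homomorphisms), homomorphic images and finite direct
products. -/
structure IsPseudovariety (V : Set FiniteSemigroup.{u}) : Prop where
  sub : ∀ S T : FiniteSemigroup.{u}, S ∈ V → ∀ f : T →ₙ* S, Function.Injective f → T ∈ V
  image : ∀ S T : FiniteSemigroup.{u}, S ∈ V → ∀ f : S →ₙ* T, Function.Surjective f → T ∈ V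
  prod : ∀ (k : ℕ) (S : Fin k → FiniteSemigroup.{u}), (∀ i, S i ∈ V) →
    FiniteSemigroup.prod S ∈ V

/-- The pseudovariety generated by a class `C`: the intersection of all pseudovarieties
containing `C`. -/
def pseudovarietyGeneratedBy (C : Set FiniteSemigroup.{u}) : Set FiniteSemigroup.{u} :=
  {S | ∀ V : Set FiniteSemigroup.{u}, IsPseudovariety V → C ⊆ V → S ∈ V}

end FiniteSemigroup

/-- A semigroup is aperiodic if each of its elements `x` satisfies `x ^ n = x ^ (n + 1)` for some
`n ≥ 1` (powers are computed in `S` with an identity adjoined, as Mathlib has no powers in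
semigroups). -/
def IsAperiodicSemigroup (S : Type*) [Semigroup S] : Prop :=
  ∀ x : S, ∃ n : ℕ, 1 ≤ n ∧ (x : WithOne S) ^ n = (x : WithOne S) ^ (n + 1)

/-- A semigroup is inverse if each of its elements has exactly one inverse. -/
def IsInverseSemigroup (S : Type*) [Semigroup S] : Prop :=
  ∀ x : S, ∃! y : S, x * y * x = x ∧ y * x * y = y

/-- The cyclic sequences `λ_{n,i}(x_1, …, x_t; z_1, …, z_n)`, with the index `i` running over
`Fin t` (so `i + k` is taken modulo `t`): `λ_{0,i} = x_i` and
`λ_{n+1,i} = λ_{n,i} z_{n+1} λ_{n,i+1} z_{n+1} ⋯ z_{n+1} λ_{n,i+t-1}`.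
Only the values `z 1, …, z n` of `z` are used. -/
def cyclicLambda {M : Type*} [Monoid M] {t : ℕ} (x : Fin t → M) (z : ℕ → M) :
    ℕ → Fin t → M
  | 0, i => x i
  | n + 1, i =>
    ((List.ofFn fun k : Fin t => cyclicLambda x z n (i + k)).intersperse (z (n + 1))).prod

/-- A semigroup is strongly Mal'cev nilpotent if there is `n ≥ 1` such that, for every `t`,
`λ_{n,1} = ⋯ = λ_{n,t}` for all `x_1, …, x_t` in `S` and `z_1, …, z_n` in `S` with an identity
adjoined. (If `S` already has an identity `e`, letting a `z_j` be the new identity has the same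
effect as letting it be `e`, so adjoining one is harmless.) -/
def IsStronglyMalcevNilpotent (S : Type*) [Semigroup S] : Prop :=
  ∃ n : ℕ, 1 ≤ n ∧ ∀ (t : ℕ) (x : Fin t → S) (z : ℕ → WithOne S) (i j : Fin t),
    cyclicLambda (fun l => (x l : WithOne S)) z n i =
      cyclicLambda (fun l => (x l : WithOne S)) z n j

namespace FiniteSemigroup

/-- The class of all finite aperiodic semigroups. -/
def aperiodic : Set FiniteSemigroup.{u} := {S | IsAperiodicSemigroup S}

/-- The class of all finite inverse semigroups. -/
def inverse : Set FiniteSemigroup.{u} := {S | IsInverseSemigroup S}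

/-- The class of all finite strongly Mal'cev nilpotent semigroups. -/
def stronglyMalcevNilpotent : Set FiniteSemigroup.{u} := {S | IsStronglyMalcevNilpotent S}

end FiniteSemigroup

/-!
The inclusion holds because `A ∩ SMN` is a pseudovariety which contains every finite aperiodic
inverse semigroup. Only the last point is not routine. The principal left ideals of the elements
`λ_{n,i}` shrink with `n`, so that, after a number of steps that depends on the semigroup alone,
three consecutive levels `a = λ_m`, `b = λ_{m+1}`, `c = λ_{m+2}` consist of elements of one rank
(`exists_rank_eq`). Think of the elements as partial injections. Constant rank then means that `z`
maps the image of `a_i` onto the domain of `a_{i+1}`, while `z'` (the next `z`) maps the image of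
`b_{i+1}`, which is that of `a_i`, onto the domain of `b_{i+2}`, which is that of `a_{i+2}`. Hence
`z⁻¹ z'` permutes the domains of the `a_i` cyclically, and aperiodicity forces these domains to
coincide. Now each `a_i z` is a permutation of the common domain, so it is the identity there by
aperiodicity again, and every `a_i` is the restriction of `z⁻¹` to the same set
(`IsInversion.eq_of_card_eq`).

The inclusion is strict because idempotents commute in every member of the pseudovariety generated
by inverse semigroups, whereas they do not in the four-element semigroup `{e, f, ef, 0}` with
`fe = 0` (`Witness`). The latter is `𝒥`-trivial: a product of the same rank as one of its outer
factors equals that factor, so constant rank forces the elements of a level to coincide.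
-/

/-! ### One step of the cyclic recursion -/

section CyclicLambda

variable {M : Type*} [Monoid M]

lemma List.mem_intersperse_of_mem {α : Type*} {a s : α} :
    ∀ {l : List α}, a ∈ l → a ∈ l.intersperse s
  | [_], h => h
  | b :: c :: l, h => by
    rw [List.intersperse_cons_cons]
    rcases List.mem_cons.1 h with rfl | h
    · simp
    · exact List.mem_cons_of_mem _ (List.mem_cons_of_mem _ (List.mem_intersperse_of_mem h))

lemma List.exists_prod_intersperse_append_singleton (a s : M) :
    ∀ l : List M, ∃ w, ((l ++ [a]).intersperse s).prod = w * a
  | [] => ⟨1, by simp⟩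
  | [b] => ⟨b * s, by simp [mul_assoc]⟩
  | b :: c :: l => by
    obtain ⟨w, hw⟩ := List.exists_prod_intersperse_append_singleton a s (c :: l)
    refine ⟨b * (s * w), ?_⟩
    simp only [List.cons_append, List.intersperse_cons_cons, List.prod_cons] at hw ⊢
    rw [hw]
    simp only [mul_assoc]

lemma cyclicLambda_succ_eq_mul_mul {t : ℕ} (x : Fin t → M) (z : ℕ → M) (n : ℕ) (i j : Fin t) :
    ∃ u v, cyclicLambda x z (n + 1) i = u * cyclicLambda x z n j * v := by
  have : NeZero t := ⟨by rintro rfl; exact i.elim0⟩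
  have hmem : cyclicLambda x z n j ∈ (List.ofFn fun k : Fin t => cyclicLambda x z n (i + k)) := by
    rw [List.mem_ofFn]
    exact ⟨j - i, by simp⟩
  obtain ⟨l₁, l₂, h⟩ := List.append_of_mem (List.mem_intersperse_of_mem (s := z (n + 1)) hmem)
  refine ⟨l₁.prod, l₂.prod, ?_⟩
  rw [cyclicLambda, h]
  simp [mul_assoc]

lemma cyclicLambda_succ_eq_mul_right {t : ℕ} (x : Fin (t + 2) → M) (z : ℕ → M) (n : ℕ)
    (i : Fin (t + 2)) :
    ∃ w, cyclicLambda x z (n + 1) i =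
      cyclicLambda x z n i * z (n + 1) * cyclicLambda x z n (i + 1) * w := by
  rw [cyclicLambda, List.ofFn_succ, List.ofFn_succ, List.intersperse_cons_cons]
  cases hl : (List.ofFn fun k : Fin t => cyclicLambda x z n (i + k.succ.succ)) with
  | nil => exact ⟨1, by simp [mul_assoc]⟩
  | cons c l => exact ⟨z (n + 1) * ((c :: l).intersperse (z (n + 1))).prod,
      by simp [mul_assoc]⟩

lemma cyclicLambda_succ_eq_mul_left {t : ℕ} (x : Fin (t + 2) → M) (z : ℕ → M) (n : ℕ)
    (i : Fin (t + 2)) :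
    ∃ w, cyclicLambda x z (n + 1) (i + 1) = w * cyclicLambda x z n i := by
  rw [cyclicLambda, List.ofFn_succ', List.concat_eq_append]
  obtain ⟨w, hw⟩ := List.exists_prod_intersperse_append_singleton
    (cyclicLambda x z n (i + 1 + Fin.last (t + 1))) (z (n + 1))
    (List.ofFn fun k : Fin (t + 1) => cyclicLambda x z n (i + 1 + k.castSucc))
  refine ⟨w, hw.trans ?_⟩
  rw [add_assoc, add_comm 1, Fin.last_add_one, add_zero]

lemma cyclicLambda_eq_of_le {t : ℕ} (x : Fin t → M) (z : ℕ → M) {m n : ℕ} (hmn : m ≤ n)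
    (h : ∀ i j, cyclicLambda x z m i = cyclicLambda x z m j) (i j : Fin t) :
    cyclicLambda x z n i = cyclicLambda x z n j := by
  induction n, hmn using Nat.le_induction generalizing i j with
  | base => exact h i j
  | succ n _ ih =>
    rw [cyclicLambda, cyclicLambda]
    congr 3
    funext k
    exact ih _ _

lemma List.map_intersperse {α β : Type*} (g : α → β) (s : α) :
    ∀ l : List α, (l.intersperse s).map g = (l.map g).intersperse (g s)
  | [] => rfl
  | [_] => rfl
  | a :: b :: l => by
    have := List.map_intersperse g s (b :: l)
    simp only [List.map_cons, List.intersperse_cons_cons] at this ⊢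
    rw [this]

lemma map_cyclicLambda {N : Type*} [Monoid N] (g : M →* N) {t : ℕ} (x : Fin t → M) (z : ℕ → M)
    (n : ℕ) (i : Fin t) :
    g (cyclicLambda x z n i) = cyclicLambda (fun l => g (x l)) (fun m => g (z m)) n i := by
  induction n generalizing i with
  | zero => rfl
  | succ n ih =>
    rw [cyclicLambda, cyclicLambda, map_list_prod, List.map_intersperse, List.map_ofFn]
    congr 3
    funext k
    exact ih _

/-- A bounded function which decreases along products stabilizes along the recursion, at a level
bounded independently of `t`. The three consecutive levels are what the case of inverse monoids
needs, since it compares two successive values of `z`. -/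
lemma exists_rank_eq (rank : M → ℕ) (hrank : ∀ u x v, rank (u * x * v) ≤ rank x) {N : ℕ}
    (hN : ∀ x, rank x ≤ N) {t : ℕ} (x : Fin t → M) (z : ℕ → M) :
    ∃ m ≤ 4 * N + 1, ∃ r, ∀ i, rank (cyclicLambda x z m i) = r ∧
      rank (cyclicLambda x z (m + 1) i) = r ∧ rank (cyclicLambda x z (m + 2) i) = r := by
  rcases isEmpty_or_nonempty (Fin t) with _ | ⟨⟨i₀⟩⟩
  · exact ⟨0, by omega, 0, fun i => isEmptyElim i⟩
  have hstep (n : ℕ) (i j : Fin t) :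
      rank (cyclicLambda x z (n + 1) i) ≤ rank (cyclicLambda x z n j) := by
    obtain ⟨u, v, h⟩ := cyclicLambda_succ_eq_mul_mul x z n i j
    rw [h]
    exact hrank _ _ _
  obtain ⟨m, hm, h⟩ : ∃ m ≤ 4 * N,
      rank (cyclicLambda x z m i₀) ≤ rank (cyclicLambda x z (m + 4) i₀) := by
    -- Otherwise the rank drops every four levels, hence below zero.
    by_contra! hc
    have key : ∀ k ≤ N + 1, rank (cyclicLambda x z (4 * k) i₀) + k ≤ N := by
      intro k
      induction k with
      | zero => intro _; simpa using hN _
      | succ k ih =>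
        intro hk
        have h₁ := ih (by omega)
        have h₂ := hc (4 * k) (by omega)
        rw [show 4 * (k + 1) = 4 * k + 4 by ring]
        omega
    have := key (N + 1) le_rfl
    omega
  refine ⟨m + 1, by omega, rank (cyclicLambda x z m i₀), fun i => ?_⟩
  have h₁ := hstep m i i₀
  have h₂ := hstep (m + 1) i i
  have h₃ := hstep (m + 2) i i
  have h₄ := hstep (m + 3) i₀ i
  simp only [add_assoc, Nat.reduceAdd] at h₁ h₂ h₃ h₄ h ⊢
  omega

end CyclicLambda

lemma Fin.eq_of_forall_add_one_eq {α : Type*} {t : ℕ} {g : Fin (t + 1) → α}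
    (h : ∀ i, g (i + 1) = g i) (i j : Fin (t + 1)) : g i = g j := by
  have h₀ (i : Fin (t + 1)) : g i = g 0 := by
    induction i using Fin.induction with
    | zero => rfl
    | succ i ih => rw [← ih, ← h i.castSucc, Fin.coeSucc_eq_succ]
  rw [h₀ i, h₀ j]

/-! ### Inverse semigroups have commuting idempotents -/

lemma IsInverseSemigroup.mul_idempotent {S : Type*} [Semigroup S] (hS : IsInverseSemigroup S)
    {e f : S} (he : e * e = e) (hf : f * f = f) : e * f * (e * f) = e * f := by
  obtain ⟨x, ⟨h₁, h₂⟩, hx⟩ := hS (e * f)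
  have he' (y : S) : e * (e * y) = e * y := by rw [← mul_assoc, he]
  have hf' (y : S) : f * (f * y) = f * y := by rw [← mul_assoc, hf]
  simp only [mul_assoc] at h₁ h₂
  -- The inverse `x` of `e * f` is `f * x * e`, hence idempotent, hence its own inverse.
  have hfx : f * (x * e) = x := by
    refine hx _ ⟨?_, ?_⟩
    · simp only [mul_assoc, he', hf', h₁]
    · simp only [mul_assoc, he', hf']
      have := congrArg (fun y => f * (y * e)) h₂
      simpa only [mul_assoc] using this
  have hxx : x * x = x := by
    have := congrArg (fun y => f * (y * e)) h₂
    simp only [mul_assoc] at this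
    calc x * x = f * (x * e) * (f * (x * e)) := by rw [hfx]
      _ = f * (x * e) := by simp only [mul_assoc]; exact this
      _ = x := hfx
  have : e * f = x := (hS x).unique
    (by simp only [mul_assoc]; exact ⟨h₂, h₁⟩) (by simp only [hxx, and_self])
  rw [this, hxx]

lemma IsInverseSemigroup.idempotents_commute {S : Type*} [Semigroup S]
    (hS : IsInverseSemigroup S) {e f : S} (he : e * e = e) (hf : f * f = f) : e * f = f * e := by
  have he' (y : S) : e * (e * y) = e * y := by rw [← mul_assoc, he]
  have hf' (y : S) : f * (f * y) = f * y := by rw [← mul_assoc, hf]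
  have hef := hS.mul_idempotent he hf
  have hfe := hS.mul_idempotent hf he
  refine (hS (e * f)).unique (by simp only [hef, and_self]) ⟨?_, ?_⟩
  · simp only [mul_assoc, he', hf'] at hef ⊢; exact hef
  · simp only [mul_assoc, he', hf'] at hfe ⊢; exact hfe

/-! ### Aperiodic inverse monoids -/

/-- The map `ι` sends each element to an inverse of it, and idempotents commute. -/
structure IsInversion {M : Type*} [Monoid M] (ι : M → M) : Prop where
  mul_mul (x : M) : x * ι x * x = x
  inv_mul_inv (x : M) : ι x * x * ι x = ι x
  comm {e f : M} : e * e = e → f * f = f → e * f = f * e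

/-- Cancellation of a power of `p`: if `p` shifts the family `e` and `q` undoes `p` on it, then
`q ^ k` undoes `p ^ k`. -/
lemma pow_mul_pow_mul_of_shift {M : Type*} [Monoid M] {t : ℕ} {e : Fin (t + 1) → M} {p q : M}
    (hp : ∀ i, p * e (i + 1) = e i * p) (hq : ∀ i, q * p * e i = e i) (k : ℕ)
    (i : Fin (t + 1)) : q ^ k * (p ^ k * e i) = e i := by
  have hp' (i) : p * e i = e (i - 1) * p := by simpa using hp (i - 1)
  have hpow (k : ℕ) : ∀ i, ∃ j, p ^ k * e i = e j * p ^ k := by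
    induction k with
    | zero => exact fun i => ⟨i, by simp⟩
    | succ k ih =>
      intro i
      obtain ⟨j, hj⟩ := ih (i - 1)
      exact ⟨j, by rw [pow_succ, mul_assoc, hp', ← mul_assoc, hj, mul_assoc]⟩
  induction k with
  | zero => simp
  | succ k ih =>
    obtain ⟨j, hj⟩ := hpow k i
    calc q ^ (k + 1) * (p ^ (k + 1) * e i)
        = q ^ k * (q * p * (p ^ k * e i)) := by rw [pow_succ, pow_succ']; simp only [mul_assoc]
      _ = q ^ k * (p ^ k * e i) := by rw [hj, ← mul_assoc (q * p), hq]
      _ = e i := ih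

/-- A family which is shifted cyclically by an aperiodic element `p`, invertibly, is constant:
`p ^ k = p ^ (k + 1)` shifts it both by `k` and by `k + 1`. -/
lemma eq_of_shift_of_pow_eq {M : Type*} [Monoid M] {t : ℕ} {e : Fin (t + 1) → M} {p q : M}
    (hp : ∀ i, p * e (i + 1) = e i * p) (hq : ∀ i, q * p * e i = e i) {k : ℕ}
    (hk : p ^ k = p ^ (k + 1)) (i : Fin (t + 1)) : e (i + 1) = e i := by
  have hp' (i) : p * e i = e (i - 1) * p := by simpa using hp (i - 1)
  have hpow (k : ℕ) : ∀ i, ∃ j, p ^ k * e i = e j * p ^ k ∧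
      p ^ (k + 1) * e (i + 1) = e j * p ^ (k + 1) := by
    induction k with
    | zero => exact fun i => ⟨i, by simp, by simpa using hp i⟩
    | succ k ih =>
      intro i
      obtain ⟨j, hj, hj'⟩ := ih (i - 1)
      rw [sub_add_cancel] at hj'
      refine ⟨j, hj', ?_⟩
      rw [pow_succ, mul_assoc, hp, ← mul_assoc, hj', mul_assoc]
  obtain ⟨j, hj, hj'⟩ := hpow k i
  rw [← hk, ← hj] at hj'
  rw [← pow_mul_pow_mul_of_shift hp hq k (i + 1), hj', pow_mul_pow_mul_of_shift hp hq]

/-- The rank of an element: the size of the left ideal it generates. -/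
noncomputable def leftIdealCard {M : Type*} [Monoid M] (x : M) : ℕ :=
  Nat.card (Set.range fun m : M => m * x)

section LeftIdealCard

variable {M : Type*} [Monoid M]

lemma range_mul_eq_image (x y : M) :
    (Set.range fun m : M => m * (x * y)) = (· * y) '' Set.range fun m : M => m * x := by
  rw [← Set.range_comp]
  simp only [Function.comp_def, mul_assoc]

variable [Finite M]

lemma leftIdealCard_mul_le_right (x y : M) : leftIdealCard (x * y) ≤ leftIdealCard y := by
  refine Nat.card_mono (Set.toFinite _) ?_
  rintro _ ⟨m, rfl⟩
  exact ⟨m * x, mul_assoc _ _ _⟩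

lemma leftIdealCard_mul_le_left (x y : M) : leftIdealCard (x * y) ≤ leftIdealCard x := by
  rw [leftIdealCard, range_mul_eq_image]
  exact Nat.card_image_le (Set.toFinite _)

lemma leftIdealCard_mul_mul_le (u x v : M) : leftIdealCard (u * x * v) ≤ leftIdealCard x :=
  (leftIdealCard_mul_le_left _ _).trans (leftIdealCard_mul_le_right _ _)

lemma leftIdealCard_le (x : M) : leftIdealCard x ≤ Nat.card M :=
  Nat.card_le_card_of_injective _ Subtype.val_injective

end LeftIdealCard

namespace IsInversion

variable {M : Type*} [Monoid M] {ι : M → M}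

lemma mul_inv_idem (hι : IsInversion ι) (x : M) : x * ι x * (x * ι x) = x * ι x := by
  rw [← mul_assoc, hι.mul_mul]

lemma inv_mul_idem (hι : IsInversion ι) (x : M) : ι x * x * (ι x * x) = ι x * x := by
  rw [← mul_assoc, hι.inv_mul_inv]

lemma mul_inv_eq_of_eq_mul (hι : IsInversion ι) {a b w w' : M} (h : b = a * w)
    (h' : a = b * w') : b * ι b = a * ι a := by
  calc b * ι b = a * ι a * (b * ι b) := by
        conv_rhs => rw [← mul_assoc, h, ← mul_assoc (a * ι a), hι.mul_mul]
        rw [h]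
    _ = b * ι b * (a * ι a) := hι.comm (hι.mul_inv_idem a) (hι.mul_inv_idem b)
    _ = a * ι a := by
        conv_lhs => rw [← mul_assoc, h', ← mul_assoc (b * ι b), hι.mul_mul]
        rw [← h']

lemma inv_mul_eq_of_eq_mul (hι : IsInversion ι) {a b w w' : M} (h : b = w * a)
    (h' : a = w' * b) : ι b * b = ι a * a := by
  calc ι b * b = ι b * b * (ι a * a) := by
        conv_rhs => rw [mul_assoc, h, mul_assoc w, ← mul_assoc a, hι.mul_mul]
        rw [h]
    _ = ι a * a * (ι b * b) := hι.comm (hι.inv_mul_idem b) (hι.inv_mul_idem a)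
    _ = ι a * a := by
        conv_lhs => rw [mul_assoc, h', mul_assoc w', ← mul_assoc b, hι.mul_mul]
        rw [← h']

variable [Finite M]

/-- Multiplication by `y` is injective on the left ideal of `x`, so `x` lies in the domain of
`y`. -/
lemma mul_mul_inv_of_card_eq (hι : IsInversion ι) {x y : M}
    (h : leftIdealCard (x * y) = leftIdealCard x) : x * y * ι y = x := by
  rw [leftIdealCard, range_mul_eq_image] at h
  have hinj : Set.InjOn (· * y) (Set.range fun m : M => m * x) :=
    Set.injOn_of_ncard_image_eq h (Set.toFinite _)
  have key : ι x * x * (y * ι y) = ι x * x := by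
    refine hinj ⟨y * ι y * ι x, ?_⟩ ⟨ι x, rfl⟩ ?_
    · change y * ι y * ι x * x = _
      rw [hι.comm (hι.inv_mul_idem x) (hι.mul_inv_idem y), mul_assoc]
    · change ι x * x * (y * ι y) * y = ι x * x * y
      rw [mul_assoc (ι x * x), hι.mul_mul]
  calc x * y * ι y = x * (ι x * x * (y * ι y)) := by
        rw [← mul_assoc x, ← mul_assoc x, hι.mul_mul, mul_assoc]
    _ = x := by rw [key, ← mul_assoc, hι.mul_mul]

/-- The left ideals of `x * y` and `y` agree, so the image of `x` contains the domain of `y`. -/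
lemma inv_mul_mul_of_card_eq (hι : IsInversion ι) {x y : M}
    (h : leftIdealCard (x * y) = leftIdealCard y) : ι x * x * y = y := by
  have hsub : (Set.range fun m : M => m * (x * y)) ⊆ Set.range fun m : M => m * y := by
    rintro _ ⟨m, rfl⟩
    exact ⟨m * x, mul_assoc _ _ _⟩
  have heq := Set.eq_of_subset_of_ncard_le hsub (le_of_eq h.symm) (Set.toFinite _)
  obtain ⟨m, hm⟩ : y ∈ Set.range fun m : M => m * (x * y) := heq ▸ ⟨1, one_mul y⟩
  have hm : m * (x * y) = y := hm
  set e := ι x * x with he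
  -- The idempotent `g = ι y * e * y` satisfies `e * y = y * g`.
  have hg : e * y = y * (ι y * e * y) := by
    calc e * y = e * (y * ι y) * y := by rw [mul_assoc e, hι.mul_mul]
      _ = y * ι y * e * y := by rw [hι.comm (hι.inv_mul_idem x) (hι.mul_inv_idem y)]
      _ = _ := by simp only [mul_assoc]
  have hxe : x * e = x := by rw [he, ← mul_assoc, hι.mul_mul]
  have hee : e * e = e := hι.inv_mul_idem x
  have hgg : y * (ι y * e * y) * (ι y * e * y) = y * (ι y * e * y) := by
    rw [← hg, mul_assoc, ← hg, ← mul_assoc, hee]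
  calc e * y = y * (ι y * e * y) := hg
    _ = m * (x * e * y) * (ι y * e * y) := by rw [hxe, hm]
    _ = m * x * (e * y * (ι y * e * y)) := by simp only [mul_assoc]
    _ = m * x * (e * y) := by rw [hg, hgg]
    _ = m * (x * e * y) := by simp only [mul_assoc]
    _ = y := by rw [hxe, hm]

/-- If `a`, `a'` and `a * z * a' * w` have the same rank, then `z` maps the image of
`a` onto the domain of `a'`. -/
lemma transport_of_card_eq (hι : IsInversion ι) {a z a' w : M} {r : ℕ} (ha : leftIdealCard a = r)
    (ha' : leftIdealCard a' = r) (h : leftIdealCard (a * z * a' * w) = r) :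
    a * z * ι z = a ∧ ι z * z * a' = a' ∧ ι a * a * z = z * (a' * ι a') := by
  have h₁ : leftIdealCard (a * z * a') = r :=
    le_antisymm (ha' ▸ leftIdealCard_mul_le_right _ _) (h ▸ leftIdealCard_mul_le_left _ _)
  have h₂ : leftIdealCard (a * z) = r :=
    le_antisymm (ha ▸ leftIdealCard_mul_le_left _ _) (h₁ ▸ leftIdealCard_mul_le_left _ _)
  have h₃ : leftIdealCard (z * a') = r :=
    le_antisymm (ha' ▸ leftIdealCard_mul_le_right _ _)
      (h₁ ▸ mul_assoc a z a' ▸ leftIdealCard_mul_le_right _ _)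
  have hR : a * z * a' * ι a' = a * z := hι.mul_mul_inv_of_card_eq (h₁.trans h₂.symm)
  have hL : ι a * a * (z * a') = z * a' :=
    hι.inv_mul_mul_of_card_eq ((mul_assoc a z a' ▸ h₁).trans h₃.symm)
  refine ⟨hι.mul_mul_inv_of_card_eq (h₂.trans ha.symm),
    hι.inv_mul_mul_of_card_eq (h₃.trans ha'.symm), ?_⟩
  calc ι a * a * z = ι a * (a * z * a' * ι a') := by rw [hR, mul_assoc]
    _ = ι a * a * (z * a') * ι a' := by simp only [mul_assoc]
    _ = z * (a' * ι a') := by rw [hL, mul_assoc]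

/-- Three consecutive levels of constant rank in an aperiodic inverse monoid: the first of them is
constant. -/
lemma eq_of_card_eq (hι : IsInversion ι) (hap : ∀ x : M, ∃ k : ℕ, x ^ k = x ^ (k + 1)) {t : ℕ}
    (x : Fin (t + 2) → M) (z : ℕ → M) {m r : ℕ}
    (h : ∀ i, leftIdealCard (cyclicLambda x z m i) = r ∧
      leftIdealCard (cyclicLambda x z (m + 1) i) = r ∧
      leftIdealCard (cyclicLambda x z (m + 2) i) = r) (i j : Fin (t + 2)) :
    cyclicLambda x z m i = cyclicLambda x z m j := by
  set a := cyclicLambda x z m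
  set b := cyclicLambda x z (m + 1) with hb
  have hab (i) : a i * z (m + 1) * ι (z (m + 1)) = a i ∧
      ι (z (m + 1)) * z (m + 1) * a (i + 1) = a (i + 1) ∧
      ι (a i) * a i * z (m + 1) = z (m + 1) * (a (i + 1) * ι (a (i + 1))) := by
    obtain ⟨w, hw⟩ := cyclicLambda_succ_eq_mul_right x z m i
    exact hι.transport_of_card_eq (h i).1 (h (i + 1)).1 (by rw [← hw]; exact (h i).2.1)
  have hbc (i) : b i * z (m + 2) * ι (z (m + 2)) = b i ∧
      ι (z (m + 2)) * z (m + 2) * b (i + 1) = b (i + 1) ∧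
      ι (b i) * b i * z (m + 2) = z (m + 2) * (b (i + 1) * ι (b (i + 1))) := by
    obtain ⟨w, hw⟩ := cyclicLambda_succ_eq_mul_right x z (m + 1) i
    exact hι.transport_of_card_eq (h i).2.1 (h (i + 1)).2.1 (by rw [← hw]; exact (h i).2.2)
  generalize z (m + 1) = y at hab
  generalize z (m + 2) = y' at hbc
  have hbe (i) : b i * ι (b i) = a i * ι (a i) := by
    obtain ⟨w, hw⟩ := cyclicLambda_succ_eq_mul_right x z m i
    simp only [mul_assoc] at hw
    refine hι.mul_inv_eq_of_eq_mul hw (w' := ι (z (m + 1) * (a (i + 1) * w))) (Eq.symm ?_)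
    rw [hb, hw]
    exact hι.mul_mul_inv_of_card_eq (by rw [← hw]; exact (h i).2.1.trans (h i).1.symm)
  have hbf (i) : ι (b (i + 1)) * b (i + 1) = ι (a i) * a i := by
    obtain ⟨w, hw⟩ := cyclicLambda_succ_eq_mul_left x z m i
    refine hι.inv_mul_eq_of_eq_mul hw (w' := ι w) (Eq.symm ?_)
    rw [hb, hw, ← mul_assoc]
    exact hι.inv_mul_mul_of_card_eq (by rw [← hw]; exact (h _).2.1.trans (h i).1.symm)
  -- The domains `e i` and images `f i` of the elements `a i`.
  set e : Fin (t + 2) → M := fun i => a i * ι (a i) with he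
  set f : Fin (t + 2) → M := fun i => ι (a i) * a i with hf
  have hfy (i) : f i * y = y * e (i + 1) := (hab i).2.2
  have hfyy (i) : f i * (y * ι y) = f i := by
    simp only [hf]
    rw [mul_assoc, ← mul_assoc (a i), (hab i).1]
  have hyye (i) : ι y * y * e i = e i := by
    have := (hab (i - 1)).2.1
    rw [sub_add_cancel] at this
    simp only [he]
    rw [← mul_assoc, this]
  have hfy' (i) : f i * y' = y' * e (i + 1 + 1) := by
    have := (hbc (i + 1)).2.2
    rwa [hbf, hbe] at this
  have hyye' (i) : ι y' * y' * e i = e i := by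
    have := (hbc (i - 1)).2.1
    rw [sub_add_cancel] at this
    simp only [he]
    rw [← hbe, ← mul_assoc, this]
  have hyf (i) : ι y * f i = e (i + 1) * ι y := by
    rw [← hfyy, ← mul_assoc (f i), hfy, ← mul_assoc, ← mul_assoc, hyye]
  have hp (i) : ι y * y' * e (i + 1) = e i * (ι y * y') := by
    have := hfy' (i - 1)
    rw [sub_add_cancel] at this
    rw [mul_assoc, ← this, ← mul_assoc, hyf, sub_add_cancel, mul_assoc]
  have hq (i) : ι y' * y * (ι y * y') * e i = e i := by
    have := hfy' (i - 1 - 1)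
    rw [sub_add_cancel, sub_add_cancel] at this
    calc ι y' * y * (ι y * y') * e i = ι y' * (y * ι y * (y' * e i)) := by simp only [mul_assoc]
      _ = ι y' * (y * ι y * f (i - 1 - 1)) * y' := by rw [← this]; simp only [mul_assoc]
      _ = ι y' * (f (i - 1 - 1) * y') := by
        rw [← hι.comm (hι.inv_mul_idem _) (hι.mul_inv_idem _), hfyy, mul_assoc]
      _ = e i := by rw [this, ← mul_assoc, hyye']
  obtain ⟨k, hk⟩ := hap (ι y * y')
  have hee := Fin.eq_of_forall_add_one_eq (eq_of_shift_of_pow_eq hp hq hk)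
  -- Each `a i` is the inverse of `y` on the common domain `e 0`.
  suffices ∀ i, a i = e 0 * ι y by rw [this i, this j]
  intro i
  have heu : e 0 * (a i * y) = a i * y := by
    rw [hee 0 i, ← mul_assoc, hι.mul_mul]
  have hue : a i * y * e 0 = a i * y := by
    rw [hee 0 (i + 1), mul_assoc, ← hfy, ← mul_assoc, ← mul_assoc, hι.mul_mul]
  have hvu : ι y * ι (a i) * (a i * y) * e 0 = e 0 := by
    rw [mul_assoc _ (a i * y), hue, mul_assoc, ← mul_assoc (ι (a i)), (hab i).2.2, ← mul_assoc]
    rw [show a (i + 1) * ι (a (i + 1)) = e 0 from hee _ _, hyye]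
  -- The constant family: `a i * y` permutes the common domain.
  obtain ⟨k, hk⟩ := hap (a i * y)
  have hc := pow_mul_pow_mul_of_shift (t := 0) (e := fun _ => e 0) (fun _ => hue.trans heu.symm)
    (fun _ => hvu) k 0
  have hone : a i * y = e 0 := by
    calc a i * y = e 0 * (a i * y) := heu.symm
      _ = (ι y * ι (a i)) ^ k * ((a i * y) ^ (k + 1) * e 0) := by
        conv_lhs => rw [← hc]
        rw [pow_succ, mul_assoc ((a i * y) ^ k), hue]
        simp only [mul_assoc] at heu ⊢
        rw [heu]
      _ = e 0 := by rw [← hk, hc]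
  rw [← hone, (hab i).1]

end IsInversion

lemma IsInverseSemigroup.withOne {S : Type*} [Semigroup S] (hS : IsInverseSemigroup S) :
    IsInverseSemigroup (WithOne S) := by
  intro x
  induction x with
  | one =>
    refine ⟨1, by simp, fun y hy => by simpa using hy.1⟩
  | coe s =>
    obtain ⟨y, ⟨h₁, h₂⟩, hy⟩ := hS s
    refine ⟨y, ⟨by exact_mod_cast h₁, by exact_mod_cast h₂⟩, ?_⟩
    intro y' h'
    induction y' with
    | one => simp at h'
    | coe s' =>
      exact congrArg _ (hy s' ⟨by exact_mod_cast h'.1, by exact_mod_cast h'.2⟩)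

lemma IsAperiodicSemigroup.exists_pow_eq {S : Type*} [Semigroup S] (hS : IsAperiodicSemigroup S)
    (x : WithOne S) : ∃ k : ℕ, x ^ k = x ^ (k + 1) := by
  induction x with
  | one => exact ⟨0, by simp⟩
  | coe s => exact (hS s).imp fun _ h => h.2

theorem IsInverseSemigroup.isStronglyMalcevNilpotent {S : Type*} [Semigroup S] [Finite S]
    (hS : IsInverseSemigroup S) (hap : IsAperiodicSemigroup S) : IsStronglyMalcevNilpotent S := by
  have : Finite (WithOne S) := inferInstanceAs (Finite (Option S))
  choose ι hι using fun x => (hS.withOne x).exists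
  have hinv : IsInversion ι :=
    ⟨fun x => (hι x).1, fun x => (hι x).2, hS.withOne.idempotents_commute⟩
  refine ⟨4 * Nat.card (WithOne S) + 1, by omega, fun t x z i j => ?_⟩
  obtain ⟨m, hm, r, h⟩ := exists_rank_eq leftIdealCard leftIdealCard_mul_mul_le
    leftIdealCard_le (fun l => (x l : WithOne S)) z
  refine cyclicLambda_eq_of_le _ _ hm (fun i j => ?_) i j
  match t with
  | 0 => exact i.elim0
  | 1 => rw [Subsingleton.elim i j]
  | t + 2 => exact hinv.eq_of_card_eq hap.exists_pow_eq _ _ h i j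

/-! ### Closure properties -/

lemma IsAperiodicSemigroup.of_injective {S T : Type*} [Semigroup S] [Semigroup T]
    (hS : IsAperiodicSemigroup S) (f : T →ₙ* S) (hf : Function.Injective f) :
    IsAperiodicSemigroup T := by
  intro x
  obtain ⟨n, hn, h⟩ := hS (f x)
  refine ⟨n, hn, WithOne.mapMulHom_injective hf ?_⟩
  simpa using h

lemma IsAperiodicSemigroup.of_surjective {S T : Type*} [Semigroup S] [Semigroup T]
    (hS : IsAperiodicSemigroup S) (f : S →ₙ* T) (hf : Function.Surjective f) :
    IsAperiodicSemigroup T := by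
  intro y
  obtain ⟨x, rfl⟩ := hf y
  obtain ⟨n, hn, h⟩ := hS x
  refine ⟨n, hn, ?_⟩
  simpa using congrArg (WithOne.mapMulHom f) h

lemma IsStronglyMalcevNilpotent.of_injective {S T : Type*} [Semigroup S] [Semigroup T]
    (hS : IsStronglyMalcevNilpotent S) (f : T →ₙ* S) (hf : Function.Injective f) :
    IsStronglyMalcevNilpotent T := by
  obtain ⟨n, hn, h⟩ := hS
  refine ⟨n, hn, fun t x z i j => WithOne.mapMulHom_injective hf ?_⟩
  rw [map_cyclicLambda, map_cyclicLambda]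
  simpa using h t (fun l => f (x l)) _ i j

lemma IsStronglyMalcevNilpotent.of_surjective {S T : Type*} [Semigroup S] [Semigroup T]
    (hS : IsStronglyMalcevNilpotent S) (f : S →ₙ* T) (hf : Function.Surjective f) :
    IsStronglyMalcevNilpotent T := by
  obtain ⟨n, hn, h⟩ := hS
  refine ⟨n, hn, fun t y z i j => ?_⟩
  have hf' : Function.Surjective (WithOne.mapMulHom f) := by
    intro y
    induction y with
    | one => exact ⟨1, map_one _⟩
    | coe y => exact (hf y).imp' _ fun x hx => by rw [WithOne.mapMulHom_coe, hx]
  choose x hx using fun l => hf (y l)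
  choose w hw using fun m => hf' (z m)
  have := congrArg (WithOne.mapMulHom f) (h t x w i j)
  rw [map_cyclicLambda, map_cyclicLambda] at this
  simpa [hx, hw] using this

/-- The components separate the elements of a product other than the adjoined identity. The
elements `a`, `b` have to lie in the semigroup because the product may be empty. -/
lemma WithOne.coe_pi_ext {ι : Type*} {S : ι → Type*} [∀ i, Semigroup (S i)] {a b : ∀ i, S i}
    (h : ∀ i, WithOne.mapMulHom (Pi.evalMulHom S i) (a : WithOne (∀ i, S i)) =
      WithOne.mapMulHom (Pi.evalMulHom S i) (b : WithOne (∀ i, S i))) :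
    a = b := by
  funext i
  simpa using h i

lemma WithOne.exists_coe_cyclicLambda {S : Type*} [Semigroup S] {t : ℕ} (x : Fin t → S)
    (z : ℕ → WithOne S) (n : ℕ) (i : Fin t) :
    ∃ s : S, cyclicLambda (fun l => (x l : WithOne S)) z n i = s := by
  induction n generalizing i with
  | zero => exact ⟨x i, rfl⟩
  | succ n ih =>
    obtain ⟨u, v, h⟩ := cyclicLambda_succ_eq_mul_mul (fun l => (x l : WithOne S)) z n i i
    obtain ⟨s, hs⟩ := ih i
    rw [h, hs]
    induction u with
    | one =>
      induction v with
      | one => exact ⟨s, by simp⟩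
      | coe v => exact ⟨s * v, by simp⟩
    | coe u =>
      induction v with
      | one => exact ⟨u * s, by simp⟩
      | coe v => exact ⟨u * s * v, by simp⟩

lemma IsAperiodicSemigroup.pi {ι : Type*} [Fintype ι] {S : ι → Type*} [∀ i, Semigroup (S i)]
    (hS : ∀ i, IsAperiodicSemigroup (S i)) : IsAperiodicSemigroup (∀ i, S i) := by
  intro x
  choose n hn h using fun i => hS i (x i)
  have hpow (k : ℕ) : ∃ y : ∀ i, S i, (x : WithOne (∀ i, S i)) ^ (k + 1) = y := by
    induction k with
    | zero => exact ⟨x, pow_one _⟩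
    | succ k ih =>
      obtain ⟨y, hy⟩ := ih
      exact ⟨y * x, by rw [pow_succ, hy, WithOne.coe_mul]⟩
  refine ⟨∑ i, n i + 1, by omega, ?_⟩
  obtain ⟨a, ha⟩ := hpow (∑ i, n i)
  obtain ⟨b, hb⟩ := hpow (∑ i, n i + 1)
  rw [ha, hb, WithOne.coe_pi_ext (a := a) (b := b)]
  intro i
  obtain ⟨d, hd⟩ := Nat.exists_eq_add_of_le
    ((Finset.single_le_sum (fun _ _ => Nat.zero_le _) (Finset.mem_univ i)).trans
      (Nat.le_succ (∑ i, n i)))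
  rw [← ha, ← hb, map_pow, map_pow]
  simp only [Nat.succ_eq_add_one] at hd
  rw [hd, WithOne.mapMulHom_coe, Pi.evalMulHom_apply, pow_add, add_right_comm, pow_add, ← h i]

lemma IsStronglyMalcevNilpotent.pi {ι : Type*} [Fintype ι] {S : ι → Type*}
    [∀ i, Semigroup (S i)] (hS : ∀ i, IsStronglyMalcevNilpotent (S i)) :
    IsStronglyMalcevNilpotent (∀ i, S i) := by
  choose n hn h using hS
  refine ⟨∑ i, n i + 1, by omega, fun t x z i j => ?_⟩
  obtain ⟨a, ha⟩ := WithOne.exists_coe_cyclicLambda x z (∑ i, n i + 1) i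
  obtain ⟨b, hb⟩ := WithOne.exists_coe_cyclicLambda x z (∑ i, n i + 1) j
  rw [ha, hb, WithOne.coe_pi_ext (a := a) (b := b)]
  intro l
  rw [← ha, ← hb, map_cyclicLambda, map_cyclicLambda]
  refine cyclicLambda_eq_of_le _ _
    ((Finset.single_le_sum (fun _ _ => Nat.zero_le _) (Finset.mem_univ l)).trans
      (Nat.le_succ (∑ i, n i))) (fun i j => ?_) i j
  simpa using h l t (fun m => x m l) _ i j

namespace FiniteSemigroup

theorem isPseudovariety_aperiodic_inter_stronglyMalcevNilpotent :
    IsPseudovariety (aperiodic.{u} ∩ stronglyMalcevNilpotent.{u}) where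
  sub _ _ hS f hf := ⟨hS.1.of_injective f hf, hS.2.of_injective f hf⟩
  image _ _ hS f hf := ⟨hS.1.of_surjective f hf, hS.2.of_surjective f hf⟩
  prod _ _ hS := ⟨IsAperiodicSemigroup.pi fun i => (hS i).1,
    IsStronglyMalcevNilpotent.pi fun i => (hS i).2⟩

/-- The class of all finite semigroups whose idempotents commute. -/
def commutingIdempotents : Set FiniteSemigroup.{u} :=
  {S | ∀ e f : S, e * e = e → f * f = f → e * f = f * e}

lemma exists_idempotent_preimage {S T : Type*} [Semigroup S] [Finite S] [Semigroup T]
    (g : S →ₙ* T) (hg : Function.Surjective g) {e : T} (he : e * e = e) :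
    ∃ s : S, s * s = s ∧ g s = e := by
  let _ : TopologicalSpace S := ⊥
  have : DiscreteTopology S := ⟨rfl⟩
  obtain ⟨s, hs, h⟩ := exists_idempotent_in_compact_subsemigroup
    (fun _ : S => continuous_of_discreteTopology) (g ⁻¹' {e}) (hg e)
    (Set.toFinite _).isCompact (fun x hx y hy => by
      simp only [Set.mem_preimage, Set.mem_singleton_iff] at hx hy ⊢
      rw [map_mul, hx, hy, he])
  exact ⟨s, h, hs⟩

theorem isPseudovariety_commutingIdempotents :
    IsPseudovariety commutingIdempotents.{u} where
  sub S T hS g hg e f he hf := hg <| by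
    rw [map_mul, map_mul]
    exact hS _ _ (by rw [← map_mul, he]) (by rw [← map_mul, hf])
  image S T hS g hg e f he hf := by
    obtain ⟨e, he', rfl⟩ := exists_idempotent_preimage g hg he
    obtain ⟨f, hf', rfl⟩ := exists_idempotent_preimage g hg hf
    rw [← map_mul, ← map_mul, hS e f he' hf']
  prod k S hS e f he hf := funext fun i => hS i _ _ (congrFun he i) (congrFun hf i)

end FiniteSemigroup

/-! ### A `𝒥`-trivial semigroup with non-commuting idempotents -/

/-- The semigroup `⟨e, f | e² = e, f² = f, fe = 0⟩` of four elements `e`, `f`, `ef`, `0`. -/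
inductive Witness : Type u
  | e
  | f
  | ef
  | zero

namespace Witness

instance : Mul Witness.{u} where
  mul
    | e, e => e
    | e, f => ef
    | e, ef => ef
    | f, f => f
    | ef, f => ef
    | _, _ => zero

instance : Semigroup Witness.{u} where
  mul_assoc a b c := by cases a <;> cases b <;> cases c <;> rfl

instance : Finite Witness.{u} :=
  Finite.of_surjective (fun i : Fin 4 => (![e, f, ef, zero] i : Witness.{u}))
    (by intro a; cases a; exacts [⟨0, rfl⟩, ⟨1, rfl⟩, ⟨2, rfl⟩, ⟨3, rfl⟩])

instance : Nonempty Witness.{u} := ⟨zero⟩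

lemma isAperiodic : IsAperiodicSemigroup Witness.{u} := by
  intro x
  refine ⟨2, by norm_num, ?_⟩
  simp only [pow_succ, pow_zero, one_mul, ← WithOne.coe_mul]
  cases x <;> rfl

/-- The height of an element of the semigroup, with an identity adjoined, in the `𝒥`-order. -/
def height : WithOne Witness.{u} → ℕ :=
  WithOne.recOneCoe 3 fun
    | e => 2
    | f => 2
    | ef => 1
    | zero => 0

lemma height_le (x : WithOne Witness.{u}) : height x ≤ 3 := by
  rcases x with _ | x
  · exact le_rfl
  · cases x <;> decide

lemma height_mul_left (x y : WithOne Witness.{u}) :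
    height (x * y) ≤ height y ∧ (height (x * y) = height y → x * y = y) := by
  rcases x with _ | x <;> rcases y with _ | y <;> try cases x
  all_goals try cases y
  all_goals exact ⟨by decide, fun h => by first | rfl | exact absurd h (by decide)⟩

lemma height_mul_right (x y : WithOne Witness.{u}) :
    height (x * y) ≤ height x ∧ (height (x * y) = height x → x * y = x) := by
  rcases x with _ | x <;> rcases y with _ | y <;> try cases x
  all_goals try cases y
  all_goals exact ⟨by decide, fun h => by first | rfl | exact absurd h (by decide)⟩

lemma isStronglyMalcevNilpotent : IsStronglyMalcevNilpotent Witness.{u} := by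
  refine ⟨4 * 3 + 1, by norm_num, fun t x z i j => ?_⟩
  obtain ⟨m, hm, r, h⟩ := exists_rank_eq height
    (fun u x v => (height_mul_right _ _).1.trans (height_mul_left _ _).1) height_le
    (fun l => (x l : WithOne Witness.{u})) z
  refine cyclicLambda_eq_of_le _ _ hm (fun i j => ?_) i j
  match t with
  | 0 => exact i.elim0
  | 1 => rw [Subsingleton.elim i j]
  | t + 2 =>
    refine Fin.eq_of_forall_add_one_eq (g := cyclicLambda _ z m) (fun i => ?_) i j
    -- `λ_{m+1,i+1}` has `λ_{m,i+1}` as a prefix and `λ_{m,i}` as a suffix.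
    obtain ⟨w, hw⟩ := cyclicLambda_succ_eq_mul_right (fun l => (x l : WithOne Witness.{u})) z m
      (i + 1)
    obtain ⟨w', hw'⟩ := cyclicLambda_succ_eq_mul_left (fun l => (x l : WithOne Witness.{u})) z m i
    have hr := (h (i + 1)).2.1
    simp only [mul_assoc] at hw
    have h₁ := (height_mul_right _ _).2 ((hw ▸ hr).trans (h (i + 1)).1.symm)
    have h₂ := (height_mul_left _ _).2 ((hw' ▸ hr).trans (h i).1.symm)
    exact h₁.symm.trans (hw.symm.trans (hw'.trans h₂))

end Witness

theorem theoremA :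
    FiniteSemigroup.pseudovarietyGeneratedBy
        (FiniteSemigroup.aperiodic.{u} ∩ FiniteSemigroup.inverse.{u}) ⊂
      FiniteSemigroup.aperiodic.{u} ∩ FiniteSemigroup.stronglyMalcevNilpotent.{u} := by
  refine ⟨fun S hS => hS _
    FiniteSemigroup.isPseudovariety_aperiodic_inter_stronglyMalcevNilpotent fun T hT =>
      ⟨hT.1, IsInverseSemigroup.isStronglyMalcevNilpotent hT.2 hT.1⟩, fun hsub => ?_⟩
  have hW := hsub (a := ⟨Witness.{u}⟩)
    ⟨Witness.isAperiodic, Witness.isStronglyMalcevNilpotent⟩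
  have hcomm := hW _ FiniteSemigroup.isPseudovariety_commutingIdempotents
    fun T hT e f he hf => IsInverseSemigroup.idempotents_commute hT.2 he hf
  have : Witness.ef = Witness.zero := hcomm Witness.e Witness.f rfl rfl
  cases this
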